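/- Let $\mathbb{T}\subset\mathbb{R}$ be a time scale (a nonempty closed set) that is unbounded above, let $t_0\in\mathbb{T}$, and write $[a,b)_{\mathbb{T}}=[a,b)\cap\mathbb{T}$ etc., $\sigma(t)=\inf(t,\infty)_{\mathbb{T}}$. Let $A:[t_0,\infty)_{\mathbb{T}}\to[0,\infty)$ and $\alpha:[t_0,\infty)_{\mathbb{T}}\to\mathbb{T}$ be rd-continuous with $\lim_{t\to\infty}\alpha(t)=\infty$, and put, for $t\in[t_0,\infty)_{\mathbb T}$, $$\alpha_*(t)=\inf\{\alpha(\eta):\eta\in[t,\infty)_{\mathbb{T}}\},\qquad \alpha_{-1}(t)=\sup\{\eta\in[t_0,\infty)_{\mathbb{T}}:\alpha_*(\eta)\le t\}.$$ Assume that 1. $\alpha(t)\le t$ and $\alpha(\sigma(t))\le t$ for all $t\in[t_0,\infty)_{\mathbb{T}}$; 2. $\displaystyle\sup_{s\in[t_0,\infty)_{\mathbb{T}}}\int_s^{\alpha_{-1}(s)}A(\eta)\,\Delta\eta<\infty$; 3. $\displaystyle\int_{t_0}^{\infty}A(\eta)\,\Delta\eta=\infty$; 4. $\displaystyle\sup_{t\in[t_0,\infty)_{\mathbb{T}}}\int_{\alpha_*(t)}^{t}A(\eta)\,\Delta\eta<1$,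 where $A$ is taken to vanish to the left of $t_0$, i.e. the lower limit is $\max\{t_0,\alpha_*(t)\}$. Then the trivial solution of $$x^{\Delta}(t)+A(t)\,x(\alpha(t))=0,\qquad t\in[t_0,\infty)_{\mathbb{T}},$$ is globally asymptotically stable, that is, it is both uniformly stable and globally attracting in the following sense. For $s\in[t_0,\infty)_{\mathbb{T}}$, $x_0\in\mathbb{R}$ and $\varphi$ rd-continuous on $[\alpha_*(s),s]_{\mathbb{T}}$, consider the initial value problem $$x^{\Delta}(t)+A(t)x(\alpha(t))=0\ \ (t\in[s,\infty)_{\mathbb{T}}),\qquad x(s)=x_0,\qquad x(t)=\varphi(t)\ \ (t\in[\alpha_*(s),s)_{\mathbb{T}}).\tag{P}$$ A solution is a function $x$ on $[\alpha_*(s),\infty)_{\mathbb T}$ with these initial data that is continuous on $[s,\infty)_{\mathbb{T}}$ and satisfies the equation there, except possibly on a countable set of right-dense points ($\Delta$-derivatives being taken on the time scale $[s,\infty)_{\mathbb T}$; since $x_0$ and $\varphi$ need not match at $s$, the derivative may fail to exist at right-dense $t$ with $\alpha(t)=s$). * Uniformly stable: for every $\varepsilon>0$ there is $\delta>0$ such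 that for all $s\in[t_0,\infty)_{\mathbb{T}}$, every solution of (P) with $|x_0|+\sup_{\eta\in[\alpha_*(s),s)_{\mathbb{T}}}|\varphi(\eta)|<\delta$ satisfies $|x(t)|<\varepsilon$ for all $t\in[s,\infty)_{\mathbb{T}}$ (a supremum over the empty set is $0$). * Globally attracting: for all $s\in[t_0,\infty)_{\mathbb{T}}$, every solution of (P) satisfies $\lim_{t\to\infty}x(t)=0$. -/

import Mathlib

open Set Filter Topology

namespace TimeScale

/-- Forward jump operator `σ(t) = inf {u ∈ S : u > t}` of a time scale `S` (unbounded above). -/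
noncomputable def sigma (S : Set ℝ) (t : ℝ) : ℝ := sInf (S ∩ Ioi t)

/-- `f` has `Δ`-derivative `f'` at the point `t` of the time scale `S`: for every `ε > 0`,
`|[f(σ(t)) - f(u)] - f' (σ(t) - u)| ≤ ε |σ(t) - u|` for all `u ∈ S` in a neighbourhood of `t`. -/
def HasDeltaDerivAt (S : Set ℝ) (f : ℝ → ℝ) (f' t : ℝ) : Prop :=
  ∀ ε > 0, ∀ᶠ u in 𝓝[S] t,
    |(f (sigma S t) - f u) - f' * (sigma S t - u)| ≤ ε * |sigma S t - u|

/-- `f` is rd-continuous on the part `D` of the time scale `T`: it is continuous at right-dense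
points and has a finite limit at left-dense points. (At a point of `D` that is not a limit of
smaller points of `D` the filter in the second clause is `⊥`, so the clause is void there.) -/
def RdContinuousOn (T D : Set ℝ) (f : ℝ → ℝ) : Prop :=
  ∀ t ∈ D, (sigma T t = t → ContinuousWithinAt f D t) ∧
    ∃ l : ℝ, Tendsto f (𝓝[D ∩ Iio t] t) (𝓝 l)

open Classical in
/-- The `Δ`-integral `∫_a^b f(η) Δη = F(b) - F(a)` on the time scale `S`, where `F` is an
antiderivative of `f`, i.e. `F^Δ = f` on `S` (every rd-continuous `f` has one, and it is unique
on `S` up to a constant). The value is `0` if `f` has no antiderivative on `S`. -/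
noncomputable def deltaIntegral (S : Set ℝ) (f : ℝ → ℝ) (a b : ℝ) : ℝ :=
  if h : ∃ F : ℝ → ℝ, ∀ t ∈ S, HasDeltaDerivAt S F (f t) t then h.choose b - h.choose a else 0

/-- `t → ∞` through points of `T`. -/
def atTopIn (T : Set ℝ) : Filter ℝ := atTop ⊓ 𝓟 T

/-- `α_*(t) = inf {α(η) : η ∈ T, η ≥ t}`. -/
noncomputable def alphaStar (T : Set ℝ) (α : ℝ → ℝ) (t : ℝ) : ℝ := sInf (α '' (T ∩ Ici t))

/-- `α_{-1}(s) = sup {η ∈ T : η ≥ t₀, α_*(η) ≤ s}`. -/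
noncomputable def alphaInv (T : Set ℝ) (t₀ : ℝ) (α : ℝ → ℝ) (s : ℝ) : ℝ :=
  sSup {η : ℝ | η ∈ T ∧ t₀ ≤ η ∧ alphaStar T α η ≤ s}

/-- `x` solves the initial value problem
`x^Δ(t) + A(t) x(α(t)) = 0` for `t ∈ [s, ∞)_T`, `x(s) = x₀`, `x = φ` on `[α_*(s), s)_T`.

The initial value `x₀` need not continue the initial function `φ`. When it does not, the right-hand
side may jump at a right-dense `t` with `α(t) = s`, and `x` has no derivative there. Hence a
countable set `N` of right-dense points may be exempted from the equation, `x` remaining continuous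
there. Functions that satisfy the equation at every point of `[s, ∞)_T` are the case `N = ∅`. -/
structure IsSolution (T : Set ℝ) (A α : ℝ → ℝ) (s x₀ : ℝ) (φ x : ℝ → ℝ) : Prop where
  initial_value : x s = x₀
  initial_function : ∀ t ∈ T ∩ Ico (alphaStar T α s) s, x t = φ t
  continuousOn : ContinuousOn x (T ∩ Ici s)
  equation : ∃ N : Set ℝ, N.Countable ∧ (∀ t ∈ N, sigma T t = t) ∧
    ∀ t ∈ T ∩ Ici s, t ∉ N → HasDeltaDerivAt (T ∩ Ici s) x (-(A t * x (α t))) t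

/-- Uniform stability of the trivial solution. (The supremum over an empty `[α_*(s), s)_T`
is `0`.) -/
def UniformlyStable (T : Set ℝ) (t₀ : ℝ) (A α : ℝ → ℝ) : Prop :=
  ∀ ε > 0, ∃ δ > 0, ∀ s ∈ T ∩ Ici t₀, ∀ (x₀ : ℝ) (φ x : ℝ → ℝ),
    RdContinuousOn T (T ∩ Icc (alphaStar T α s) s) φ → IsSolution T A α s x₀ φ x →
    |x₀| + sSup ((fun η => |φ η|) '' (T ∩ Ico (alphaStar T α s) s)) < δ →
    ∀ t ∈ T ∩ Ici s, |x t| < ε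

/-- Global attractivity of the trivial solution. -/
def GloballyAttracting (T : Set ℝ) (t₀ : ℝ) (A α : ℝ → ℝ) : Prop :=
  ∀ s ∈ T ∩ Ici t₀, ∀ (x₀ : ℝ) (φ x : ℝ → ℝ),
    RdContinuousOn T (T ∩ Icc (alphaStar T α s) s) φ → IsSolution T A α s x₀ φ x →
    Tendsto x (atTopIn T) (𝓝 0)

/-- Global asymptotic stability of the trivial solution. -/
def GloballyAsymptoticallyStable (T : Set ℝ) (t₀ : ℝ) (A α : ℝ → ℝ) : Prop :=
  UniformlyStable T t₀ A α ∧ GloballyAttracting T t₀ A α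

end TimeScale

/-!
The equation is compared with the antiderivative `F` of the coefficient `A`: since `A ≥ 0`, a bound
`-x(α) ≤ C` on `[a, b)` gives `x b - x a ≤ C (F b - F a)` (`IsSolution.sub_le`). This rests on
a mean value inequality with a countable exceptional set of right-dense points
(`le_of_deltaDeriv_nonpos`), proved by induction along the time scale at a level which the function
does not take on the exceptional set.

The heart of the argument is that a solution with `|x| ≤ M` on the relevant past cannot cross any
level `c > ν M` upwards, where `ν < 1` bounds the integrals of `A` over the windows `[α_*(t), t]`
(`IsSolution.barrier_step`). To grow at `t` it needs `x(α t) < 0`. But then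
`x t ≤ x(α t) + ν M ≤ ν M`, because `[α t, t]` lies in one window. If moreover `t` is
right-scattered, let `b` be the integral of `A` over the jump from `t` to `σ t`. From `α(σ t) ≤ t`
it follows that the jump lies in the window ending at `σ t`, so `b ≤ ν < 1` and
`x(σ t) = x t - b x(α t) ≤ (1 - b) x(α t) + ν M ≤ ν M`.

Uniform stability: a Grönwall estimate controls `x` up to `α_{-1}(s)`, uniformly in `s` because
the integrals of `A` over `[s, α_{-1}(s)]` are bounded; after that time the barrier applied to `x` and `-x` with `c = M` keeps
`|x| ≤ M` (`IsSolution.abs_le_of_init`). Attraction: if eventually `|x| ≤ M`, then `x` must at some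
time be at most `ν M`, as otherwise `x` would decrease at the rate `ν M A`, whose integral diverges;
the barrier then keeps `x ≤ ν M`. Applied to `x` and `-x` and iterated, this gives `|x| ≤ νⁿ M`
eventually for every `n` (`IsSolution.eventually_le_mul`, `IsSolution.tendsto_zero`).
-/

namespace TimeScale

/-! ### Time scales, induction, and the `Δ`-derivative -/

theorem sigma_mem {S : Set ℝ} (hS : IsClosed S) (hub : ¬ BddAbove S) (t : ℝ) : sigma S t ∈ S := by
  obtain ⟨u, hu, htu⟩ := not_bddAbove_iff.1 hub t
  have h : sigma S t ∈ closure (S ∩ Ioi t) :=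
    csInf_mem_closure ⟨u, hu, htu⟩ ⟨t, fun v hv => hv.2.le⟩
  exact hS.closure_subset (closure_mono inter_subset_left h)

theorem le_sigma {S : Set ℝ} (hub : ¬ BddAbove S) (t : ℝ) : t ≤ sigma S t := by
  obtain ⟨u, hu, htu⟩ := not_bddAbove_iff.1 hub t
  exact le_csInf ⟨u, hu, htu⟩ fun v hv => hv.2.le

theorem sigma_le {S : Set ℝ} {t u : ℝ} (hu : u ∈ S) (htu : t < u) : sigma S t ≤ u :=
  csInf_le ⟨t, fun _ hv => hv.2.le⟩ ⟨hu, htu⟩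

theorem sigma_inter_Ici {T : Set ℝ} {s t : ℝ} (hst : s ≤ t) :
    sigma (T ∩ Ici s) t = sigma T t := by
  unfold sigma
  congr 1
  ext u
  constructor
  · rintro ⟨⟨h1, -⟩, h2⟩
    exact ⟨h1, h2⟩
  · rintro ⟨h1, h2⟩
    exact ⟨⟨h1, hst.trans (le_of_lt h2)⟩, h2⟩

/-- Induction along a time scale for an inequality between continuous functions: it suffices to
pass from `[a, t]` to `σ t` when `t` is right-scattered and to points slightly to the right of `t`
when `t` is right-dense. Continuity takes care of left-dense points. -/
theorem le_induction {S : Set ℝ} (hS : IsClosed S) {a b : ℝ} (ha : a ∈ S) {g h : ℝ → ℝ}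
    (hg : ContinuousOn g (S ∩ Icc a b)) (hh : ContinuousOn h (S ∩ Icc a b)) (h0 : g a ≤ h a)
    (hscat : ∀ t ∈ S ∩ Ico a b, t < sigma S t → (∀ u ∈ S ∩ Icc a t, g u ≤ h u) →
      g (sigma S t) ≤ h (sigma S t))
    (hdense : ∀ t ∈ S ∩ Ico a b, sigma S t = t → (∀ u ∈ S ∩ Icc a t, g u ≤ h u) →
      ∀ᶠ u in 𝓝[S ∩ Ioi t] t, g u ≤ h u) :
    ∀ t ∈ S ∩ Icc a b, g t ≤ h t := by
  by_contra! hcon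
  obtain ⟨t, ht, hbad⟩ := hcon
  set Bd : Set ℝ := {t | t ∈ S ∩ Icc a b ∧ h t < g t} with hBd
  have hne : Bd.Nonempty := ⟨t, ht, hbad⟩
  have hbb : BddBelow Bd := ⟨a, fun u hu => hu.1.2.1⟩
  set m := sInf Bd with hm
  have hmS : m ∈ S ∩ Icc a b :=
    (hS.inter isClosed_Icc).closure_subset
      (closure_mono (fun u (hu : u ∈ Bd) => hu.1) (csInf_mem_closure hne hbb))
  have hbelow : ∀ u ∈ S ∩ Ico a m, g u ≤ h u := by
    intro u hu
    by_contra! hgu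
    exact absurd (csInf_le hbb ⟨⟨hu.1, hu.2.1, hu.2.2.le.trans hmS.2.2⟩, hgu⟩) (not_le.2 hu.2.2)
  by_cases hgm : g m ≤ h m
  · -- The first bad points accumulate at `m` from the right.
    have hgt : ∀ u ∈ Bd, m < u := fun u hu =>
      lt_of_le_of_ne (csInf_le hbb hu) (by rintro rfl; exact absurd hu.2 (not_lt.2 hgm))
    have hmb : m < b := (hgt t ⟨ht, hbad⟩).trans_le ht.2.2
    have hsig : sigma S m = m := by
      apply le_antisymm
      · exact le_csInf hne fun u hu => sigma_le hu.1.1 (hgt u hu)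
      · exact le_csInf ⟨t, ht.1, hgt t ⟨ht, hbad⟩⟩ fun v hv => hv.2.le
    have hev := hdense m ⟨hmS.1, hmS.2.1, hmb⟩ hsig (by
      intro u hu
      rcases hu.2.2.lt_or_eq with h1 | h1
      · exact hbelow u ⟨hu.1, hu.2.1, h1⟩
      · rw [h1]; exact hgm)
    rw [eventually_nhdsWithin_iff, Metric.eventually_nhds_iff] at hev
    obtain ⟨δ, hδ, hev⟩ := hev
    obtain ⟨u, hu, hud⟩ := exists_lt_of_csInf_lt hne (show sInf Bd < m + δ by linarith)
    have hmu := hgt u hu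
    have := hev (y := u) (by rw [Real.dist_eq, abs_of_pos (by linarith)]; linarith) ⟨hu.1.1, hmu⟩
    exact absurd hu.2 (not_lt.2 this)
  · have ham : a < m := lt_of_le_of_ne hmS.2.1 (by rintro h1; rw [← h1] at hgm; exact hgm h0)
    by_cases hcl : m ∈ closure (S ∩ Ico a m)
    · have hsub : S ∩ Ico a m ⊆ S ∩ Icc a b := fun u hu =>
        ⟨hu.1, hu.2.1, hu.2.2.le.trans hmS.2.2⟩
      exact hgm (ContinuousWithinAt.closure_le hcl ((hg m hmS).mono hsub) ((hh m hmS).mono hsub)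
        hbelow)
    · -- `m` is left-scattered, so it is the jump of its predecessor.
      set r := sSup (S ∩ Ico a m) with hr
      have hne' : (S ∩ Ico a m).Nonempty := ⟨a, ha, le_rfl, ham⟩
      have hba' : BddAbove (S ∩ Ico a m) := ⟨m, fun u hu => hu.2.2.le⟩
      have hrcl : r ∈ closure (S ∩ Ico a m) := csSup_mem_closure hne' hba'
      have hrS : r ∈ S ∩ Icc a m :=
        (hS.inter isClosed_Icc).closure_subset
          (closure_mono (inter_subset_inter_right S Ico_subset_Icc_self) hrcl)
      have hrm : r < m := lt_of_le_of_ne hrS.2.2 (by rintro h1; rw [h1] at hrcl; exact hcl hrcl)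
      have hsig : sigma S r = m := by
        apply le_antisymm (sigma_le hmS.1 hrm)
        refine le_csInf ⟨m, hmS.1, hrm⟩ fun v hv => ?_
        by_contra! hvm
        exact absurd (le_csSup hba' ⟨hv.1, hrS.2.1.trans (le_of_lt hv.2), hvm⟩)
          (not_le.2 hv.2)
      have := hscat r ⟨hrS.1, hrS.2.1, hrm.trans_le hmS.2.2⟩ (by rw [hsig]; exact hrm)
        (fun u hu => hbelow u ⟨hu.1, hu.2.1, hu.2.2.trans_lt hrm⟩)
      rw [hsig] at this
      exact hgm this

theorem nhdsWithin_inter_Ioi_le {S : Set ℝ} {a b t : ℝ} (hat : a ≤ t) (htb : t < b) :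
    𝓝[S ∩ Ioi t] t ≤ 𝓝[S ∩ Icc a b] t := by
  rw [nhdsWithin_le_iff, mem_nhdsWithin]
  exact ⟨Iio b, isOpen_Iio, htb, fun u hu => ⟨hu.2.1, hat.trans (le_of_lt hu.2.2), le_of_lt hu.1⟩⟩

theorem HasDeltaDerivAt.inter_Ici {T : Set ℝ} {f : ℝ → ℝ} {f' t t₀ s : ℝ}
    (h : HasDeltaDerivAt (T ∩ Ici t₀) f f' t) (hs : t₀ ≤ s) (hst : s ≤ t) :
    HasDeltaDerivAt (T ∩ Ici s) f f' t := by
  intro ε hε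
  have h1 := h ε hε
  rw [sigma_inter_Ici (hs.trans hst)] at h1
  rw [sigma_inter_Ici hst]
  exact h1.filter_mono (nhdsWithin_mono _ (inter_subset_inter_right T (Ici_subset_Ici.2 hs)))

/-- The increment of a `Δ`-differentiable function over the jump from `t` to `σ t`. -/
theorem HasDeltaDerivAt.jump {S : Set ℝ} {f : ℝ → ℝ} {f' t : ℝ} (h : HasDeltaDerivAt S f f' t)
    (ht : t ∈ S) : f (sigma S t) - f t = f' * (sigma S t - t) := by
  have h1 : ∀ ε > 0, |(f (sigma S t) - f t) - f' * (sigma S t - t)| ≤ ε * |sigma S t - t| :=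
    fun ε hε => (h ε hε).self_of_nhdsWithin ht
  by_contra hne
  have hpos : 0 < |(f (sigma S t) - f t) - f' * (sigma S t - t)| :=
    abs_pos.2 (sub_ne_zero.2 hne)
  set p := |(f (sigma S t) - f t) - f' * (sigma S t - t)|
  set q := |sigma S t - t|
  have hq : 0 ≤ q := abs_nonneg _
  have h2 := h1 (p / (2 * (q + 1))) (by positivity)
  have h3 : p / (2 * (q + 1)) * q ≤ p / 2 := by
    rw [div_mul_eq_mul_div, div_le_div_iff₀ (by positivity) (by norm_num)]
    nlinarith
  linarith

theorem HasDeltaDerivAt.add_const_mul {S : Set ℝ} {f g : ℝ → ℝ} {f' g' t : ℝ}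
    (hf : HasDeltaDerivAt S f f' t) (hg : HasDeltaDerivAt S g g' t) (c : ℝ) :
    HasDeltaDerivAt S (fun u => f u + c * g u) (f' + c * g') t := by
  intro ε hε
  have hc : 0 < 1 + |c| := by positivity
  filter_upwards [hf (ε / (1 + |c|)) (by positivity), hg (ε / (1 + |c|)) (by positivity)]
    with u h1 h2
  set d := sigma S t - u
  have e1 : (f (sigma S t) + c * g (sigma S t) - (f u + c * g u)) - (f' + c * g') * d =
      ((f (sigma S t) - f u) - f' * d) + c * ((g (sigma S t) - g u) - g' * d) := by ring
  rw [e1]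
  refine (abs_add_le _ _).trans ?_
  rw [abs_mul]
  have h3 := mul_le_mul_of_nonneg_left h2 (abs_nonneg c)
  have e2 : ε * |d| = ε / (1 + |c|) * |d| + |c| * (ε / (1 + |c|) * |d|) := by
    field_simp
  linarith

theorem HasDeltaDerivAt.continuousWithinAt {S : Set ℝ} {f : ℝ → ℝ} {f' t : ℝ}
    (h : HasDeltaDerivAt S f f' t) (ht : t ∈ S) : ContinuousWithinAt f S t := by
  have hj := h.jump ht
  set q := |sigma S t - t|
  have hq : 0 ≤ q := abs_nonneg _
  rw [Metric.continuousWithinAt_iff']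
  intro ε hε
  have h1 := h (ε / (2 * (q + 1))) (by positivity)
  have h2 : ∀ᶠ u in 𝓝[S] t, |t - u| < min 1 (ε / (2 * (|f'| + 1))) := by
    have : Tendsto (fun u => |t - u|) (𝓝[S] t) (𝓝 |t - t|) :=
      ((continuous_const.sub continuous_id).abs.tendsto t).mono_left nhdsWithin_le_nhds
    rw [sub_self, abs_zero] at this
    exact this.eventually_lt_const (by positivity)
  filter_upwards [h1, h2] with u hu1 hu2
  have hd1 : |t - u| ≤ 1 := (lt_min_iff.1 hu2).1.le
  have hd2 : |t - u| < ε / (2 * (|f'| + 1)) := (lt_min_iff.1 hu2).2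
  have e1 : f u - f t = -((f (sigma S t) - f u) - f' * (sigma S t - u)) - f' * (t - u) := by
    linarith
  rw [Real.dist_eq, e1]
  refine (abs_sub _ _).trans_lt ?_
  rw [abs_neg, abs_mul]
  have e2 : |sigma S t - u| ≤ q + 1 := by
    have : sigma S t - u = (sigma S t - t) + (t - u) := by ring
    rw [this]
    exact (abs_add_le _ _).trans (by gcongr)
  have e3 : ε / (2 * (q + 1)) * |sigma S t - u| ≤ ε / 2 := by
    calc _ ≤ ε / (2 * (q + 1)) * (q + 1) := by gcongr
      _ = ε / 2 := by field_simp
  have e4 : |f'| * |t - u| < ε / 2 := by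
    calc _ ≤ (|f'| + 1) * |t - u| := by nlinarith [abs_nonneg (t - u)]
      _ < (|f'| + 1) * (ε / (2 * (|f'| + 1))) := by gcongr
      _ = ε / 2 := by field_simp
  linarith

/-- Mean value inequality with a countable set `N` of exceptional right-dense points. -/
theorem le_of_deltaDeriv_nonpos {S : Set ℝ} (hS : IsClosed S) {a b : ℝ} (ha : a ∈ S) (hb : b ∈ S)
    (hab : a ≤ b) {g g' : ℝ → ℝ} (hg : ContinuousOn g (S ∩ Icc a b)) {N : Set ℝ}
    (hN : N.Countable) (hNd : ∀ t ∈ N, sigma S t = t)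
    (hd : ∀ t ∈ S ∩ Ico a b, t ∉ N → HasDeltaDerivAt S g (g' t) t ∧ g' t ≤ 0) :
    g b ≤ g a := by
  -- Subtracting `ε t` makes the derivative strictly negative.
  have key : ∀ ε > 0, g b - ε * b ≤ g a - ε * a := by
    intro ε hε
    set G : ℝ → ℝ := fun t => g t - ε * t with hG
    have hGc : ContinuousOn G (S ∩ Icc a b) := hg.sub (continuousOn_const.mul continuousOn_id)
    by_contra! hlt
    -- A level `c` that `G` does not take on `N` makes the exceptional points harmless.
    obtain ⟨c, hcN, hc1, hc2⟩ := ((hN.image G).dense_compl ℝ).exists_between hlt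
    refine absurd (le_induction (g := G) (h := fun _ => c) hS ha hGc continuousOn_const hc1.le
      ?_ ?_ b ⟨hb, hab, le_rfl⟩) (not_le.2 hc2)
    · intro t ht hσ hle
      have htN : t ∉ N := fun h => hσ.ne' (hNd t h)
      obtain ⟨hd1, hd2⟩ := hd t ht htN
      have hj := hd1.jump ht.1
      have := hle t ⟨ht.1, ht.2.1, le_rfl⟩
      simp only [hG] at this ⊢
      nlinarith [mul_nonneg (neg_nonneg.2 hd2) (sub_pos.2 hσ).le, mul_pos hε (sub_pos.2 hσ)]
    · intro t ht hσ hle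
      rcases (hle t ⟨ht.1, ht.2.1, le_rfl⟩).lt_or_eq with hlt' | heq
      · have h1 := (hGc t ⟨ht.1, ht.2.1, ht.2.2.le⟩).tendsto.eventually_lt_const hlt'
        exact (h1.filter_mono (nhdsWithin_inter_Ioi_le ht.2.1 ht.2.2)).mono fun u hu => hu.le
      · have htN : t ∉ N := fun h => hcN ⟨t, h, heq⟩
        obtain ⟨hd1, hd2⟩ := hd t ht htN
        have h1 := hd1 ε hε
        rw [hσ] at h1
        filter_upwards [h1.filter_mono (nhdsWithin_mono t inter_subset_left),
          self_mem_nhdsWithin] with u hu hu'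
        have htu : t < u := hu'.2
        rw [abs_sub_comm t u, abs_of_pos (sub_pos.2 htu)] at hu
        have := (abs_le.1 hu).1
        rw [← heq]
        simp only [hG]
        nlinarith [mul_nonneg (neg_nonneg.2 hd2) (sub_pos.2 htu).le]
  have h2 : Tendsto (fun ε : ℝ => g a + ε * (b - a)) (𝓝[>] 0) (𝓝 (g a + 0 * (b - a))) :=
    ((continuous_const.add (continuous_id.mul continuous_const)).tendsto 0).mono_left
      nhdsWithin_le_nhds
  rw [zero_mul, add_zero] at h2
  refine ge_of_tendsto h2 ?_
  filter_upwards [self_mem_nhdsWithin] with ε hε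
  have := key ε hε
  linarith

/-- Rd-continuous functions are bounded on compact sets: near a right-scattered point only its left
neighbours matter, and there the one-sided limit exists. -/
theorem RdContinuousOn.isBounded_image {T D : Set ℝ} {f : ℝ → ℝ} (hub : ¬ BddAbove T)
    (hDT : D ⊆ T) (hf : RdContinuousOn T D f) {k : Set ℝ} (hk : IsCompact k) (hkD : k ⊆ D) :
    Bornology.IsBounded (f '' k) := by
  refine hk.induction_on (p := fun k => Bornology.IsBounded (f '' k)) (by simp)
    (fun s t hst ht => ht.subset (image_mono hst))
    (fun s t hs ht => by rw [image_union]; exact hs.union ht) ?_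
  intro t ht
  obtain ⟨h1, l, hl⟩ := hf t (hkD ht)
  have hball : ∀ {F : Filter ℝ} {y : ℝ}, Tendsto f F (𝓝 y) → ∀ᶠ u in F, f u ∈ Metric.ball y 1 :=
    fun h => h (Metric.ball_mem_nhds _ one_pos)
  rcases (le_sigma hub t).eq_or_lt with h2 | h2
  · refine ⟨{u | f u ∈ Metric.ball (f t) 1}, ?_, ?_⟩
    · exact nhdsWithin_mono t hkD (hball (h1 h2.symm))
    · exact Metric.isBounded_ball.subset (by rintro _ ⟨u, hu, rfl⟩; exact hu)
  · refine ⟨{u | f u ∈ Metric.ball l 1} ∪ {t}, ?_, ?_⟩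
    · have h3 : ∀ᶠ u in 𝓝 t, u ∈ D ∩ Iio t → f u ∈ Metric.ball l 1 :=
        eventually_nhdsWithin_iff.1 (hball hl)
      rw [mem_nhdsWithin_iff_eventually]
      filter_upwards [h3, eventually_lt_nhds h2] with u hu hu2 huk
      rcases lt_trichotomy u t with h | h | h
      · exact Or.inl (hu ⟨hkD huk, h⟩)
      · exact Or.inr h
      · exact absurd (sigma_le (hDT (hkD huk)) h) (not_le.2 hu2)
    · rw [image_union, image_singleton]
      exact (Metric.isBounded_ball.subset (by rintro _ ⟨u, hu, rfl⟩; exact hu)).union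
        Bornology.isBounded_singleton

/-! ### The delay and the integral of the coefficient -/

/-- The standing hypotheses on the delay equation `x^Δ + A x(α) = 0` in the form in which they are
used: the `Δ`-integral of `A` is expressed by an antiderivative `F`, and the integrals over the
windows `[α_*(t), t]` are bounded by a constant `ν ∈ (0, 1)`. -/
structure DelayHypotheses (T : Set ℝ) (t₀ : ℝ) (A α F : ℝ → ℝ) (ν : ℝ) : Prop where
  closed : IsClosed T
  not_bddAbove : ¬ BddAbove T
  base_mem : t₀ ∈ T
  coeff_nonneg : ∀ t ∈ T ∩ Ici t₀, 0 ≤ A t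
  delay_rdContinuous : RdContinuousOn T (T ∩ Ici t₀) α
  delay_mem : ∀ t ∈ T ∩ Ici t₀, α t ∈ T
  delay_tendsto : Tendsto α (atTopIn T) atTop
  delay_le : ∀ t ∈ T ∩ Ici t₀, α t ≤ t
  delay_sigma_le : ∀ t ∈ T ∩ Ici t₀, α (sigma T t) ≤ t
  deriv : ∀ t ∈ T ∩ Ici t₀, HasDeltaDerivAt (T ∩ Ici t₀) F (A t) t
  window : ∀ t ∈ T ∩ Ici t₀, F t - F (max t₀ (alphaStar T α t)) ≤ ν
  pos : 0 < ν
  lt_one : ν < 1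

theorem eventually_atTopIn {T : Set ℝ} {p : ℝ → Prop} :
    (∀ᶠ t in atTopIn T, p t) ↔ ∃ R, ∀ t ∈ T, R ≤ t → p t := by
  rw [atTopIn, eventually_inf_principal, eventually_atTop]
  exact ⟨fun ⟨R, h⟩ => ⟨R, fun t ht hR => h t hR ht⟩, fun ⟨R, h⟩ => ⟨R, fun t hR ht => h t ht hR⟩⟩

theorem atTopIn_neBot {T : Set ℝ} (hub : ¬ BddAbove T) : (atTopIn T).NeBot := by
  rw [← frequently_true_iff_neBot]
  intro h
  obtain ⟨R, hR⟩ := eventually_atTopIn.1 h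
  obtain ⟨u, hu, hRu⟩ := not_bddAbove_iff.1 hub R
  exact hR u hu hRu.le trivial

namespace DelayHypotheses

variable {T : Set ℝ} {t₀ : ℝ} {A α F : ℝ → ℝ} {ν : ℝ}

theorem isClosed_Ici (P : DelayHypotheses T t₀ A α F ν) (s : ℝ) : IsClosed (T ∩ Ici s) :=
  P.closed.inter _root_.isClosed_Ici

theorem continuousOn (P : DelayHypotheses T t₀ A α F ν) : ContinuousOn F (T ∩ Ici t₀) :=
  fun t ht => (P.deriv t ht).continuousWithinAt ht

theorem mono (P : DelayHypotheses T t₀ A α F ν) {u v : ℝ} (hu : u ∈ T ∩ Ici t₀) (hv : v ∈ T)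
    (huv : u ≤ v) : F u ≤ F v := by
  have h : (fun t => 0 + (-1) * F t) v ≤ (fun t => 0 + (-1) * F t) u := by
    refine le_of_deltaDeriv_nonpos (P.isClosed_Ici t₀) (g := fun t => 0 + (-1) * F t)
      (g' := fun t => 0 + (-1) * A t) hu
      ⟨hv, hu.2.trans huv⟩ huv ?_ countable_empty (by simp) ?_
    · exact continuousOn_const.add (continuousOn_const.mul (P.continuousOn.mono inter_subset_left))
    · intro t ht _
      refine ⟨HasDeltaDerivAt.add_const_mul (f := fun _ => 0) ?_ (P.deriv t ht.1) _, ?_⟩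
      · intro ε hε
        filter_upwards with w
        simp only [sub_self, zero_mul, abs_zero]
        positivity
      · have := P.coeff_nonneg t ht.1
        linarith
  simp only at h
  linarith

theorem exists_delay_ge (P : DelayHypotheses T t₀ A α F ν) (r : ℝ) :
    ∃ R, ∀ t ∈ T, R ≤ t → r ≤ α t :=
  eventually_atTopIn.1 (P.delay_tendsto.eventually_ge_atTop r)

/-- The delay has a lower bound on `[t, ∞)`: it tends to `∞`, and it is bounded on compact sets. -/
theorem bddBelow_delay (P : DelayHypotheses T t₀ A α F ν) {t : ℝ} (ht : t₀ ≤ t) :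
    BddBelow (α '' (T ∩ Ici t)) := by
  obtain ⟨R, hR⟩ := P.exists_delay_ge 0
  have hk : IsCompact (T ∩ Icc t R) := isCompact_Icc.inter_left P.closed
  obtain ⟨m, hm⟩ := (P.delay_rdContinuous.isBounded_image P.not_bddAbove inter_subset_left hk
    (fun u hu => ⟨hu.1, ht.trans hu.2.1⟩)).bddBelow
  refine ⟨min m 0, ?_⟩
  rintro _ ⟨u, hu, rfl⟩
  rcases le_total u R with h | h
  · exact (min_le_left _ _).trans (hm ⟨u, ⟨hu.1, hu.2, h⟩, rfl⟩)
  · exact (min_le_right _ _).trans (hR u hu.1 h)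

theorem alphaStar_le (P : DelayHypotheses T t₀ A α F ν) {t u : ℝ} (ht : t₀ ≤ t) (hu : u ∈ T)
    (htu : t ≤ u) : alphaStar T α t ≤ α u :=
  csInf_le (P.bddBelow_delay ht) ⟨u, ⟨hu, htu⟩, rfl⟩

theorem alphaStar_le_self (P : DelayHypotheses T t₀ A α F ν) {t : ℝ} (ht : t ∈ T ∩ Ici t₀) :
    alphaStar T α t ≤ t :=
  (P.alphaStar_le ht.2 ht.1 le_rfl).trans (P.delay_le t ht)

theorem le_alphaStar (P : DelayHypotheses T t₀ A α F ν) {t r : ℝ}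
    (h : ∀ u ∈ T, t ≤ u → r ≤ α u) : r ≤ alphaStar T α t := by
  obtain ⟨u, hu, htu⟩ := not_bddAbove_iff.1 P.not_bddAbove t
  refine le_csInf ⟨α u, u, ⟨hu, htu.le⟩, rfl⟩ ?_
  rintro _ ⟨v, hv, rfl⟩
  exact h v hv.1 hv.2

theorem alphaStar_mono (P : DelayHypotheses T t₀ A α F ν) {t u : ℝ} (ht : t₀ ≤ t) (htu : t ≤ u) :
    alphaStar T α t ≤ alphaStar T α u :=
  P.le_alphaStar fun _ hv huv => P.alphaStar_le ht hv (htu.trans huv)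

theorem alphaStar_mem (P : DelayHypotheses T t₀ A α F ν) {t : ℝ} (ht : t ∈ T ∩ Ici t₀) :
    alphaStar T α t ∈ T := by
  refine P.closed.closure_subset (closure_mono ?_ (csInf_mem_closure
    (⟨α t, t, ⟨ht.1, self_mem_Ici⟩, rfl⟩ : (α '' (T ∩ Ici t)).Nonempty) (P.bddBelow_delay ht.2)))
  rintro _ ⟨u, hu, rfl⟩
  exact P.delay_mem u ⟨hu.1, le_trans (mem_Ici.1 ht.2) hu.2⟩

theorem exists_alphaStar_ge (P : DelayHypotheses T t₀ A α F ν) (r : ℝ) :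
    ∃ R, ∀ t, R ≤ t → r ≤ alphaStar T α t := by
  obtain ⟨R, hR⟩ := P.exists_delay_ge r
  exact ⟨R, fun t ht => P.le_alphaStar fun u hu htu => hR u hu (ht.trans htu)⟩

theorem sub_le_of_mem_window (P : DelayHypotheses T t₀ A α F ν) {t u : ℝ} (ht : t ∈ T ∩ Ici t₀)
    (hu : u ∈ T ∩ Ici t₀) (hu1 : alphaStar T α t ≤ u) : F t - F u ≤ ν := by
  have hmem : max t₀ (alphaStar T α t) ∈ T ∩ Ici t₀ := by
    refine ⟨?_, mem_Ici.2 (le_max_left _ _)⟩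
    rcases max_choice t₀ (alphaStar T α t) with h | h
    · rw [h]; exact P.base_mem
    · rw [h]; exact P.alphaStar_mem ht
  have := P.mono hmem hu.1 (max_le hu.2 hu1)
  have := P.window t ht
  linarith

theorem bddAbove_alphaInv (P : DelayHypotheses T t₀ A α F ν) (s : ℝ) :
    BddAbove {η : ℝ | η ∈ T ∧ t₀ ≤ η ∧ alphaStar T α η ≤ s} := by
  obtain ⟨R, hR⟩ := P.exists_alphaStar_ge (s + 1)
  refine ⟨R, fun η hη => ?_⟩
  by_contra! h
  have := hR η h.le
  linarith [hη.2.2]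

theorem le_alphaInv (P : DelayHypotheses T t₀ A α F ν) {s : ℝ} (hs : s ∈ T ∩ Ici t₀) :
    s ≤ alphaInv T t₀ α s :=
  le_csSup (P.bddAbove_alphaInv s) ⟨hs.1, hs.2, P.alphaStar_le_self hs⟩

theorem alphaInv_mem (P : DelayHypotheses T t₀ A α F ν) {s : ℝ} (hs : s ∈ T ∩ Ici t₀) :
    alphaInv T t₀ α s ∈ T :=
  P.closed.closure_subset (closure_mono (fun _ h => h.1)
    (csSup_mem_closure (⟨s, hs.1, hs.2, P.alphaStar_le_self hs⟩ :
      {η : ℝ | η ∈ T ∧ t₀ ≤ η ∧ alphaStar T α η ≤ s}.Nonempty) (P.bddAbove_alphaInv s)))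

theorem lt_alphaStar_of_alphaInv_lt (P : DelayHypotheses T t₀ A α F ν) {s t : ℝ}
    (ht : t ∈ T ∩ Ici t₀) (hst : alphaInv T t₀ α s < t) : s < alphaStar T α t := by
  by_contra! h
  exact absurd (le_csSup (P.bddAbove_alphaInv s) ⟨ht.1, ht.2, h⟩) (not_le.2 hst)

end DelayHypotheses

/-! ### Integral inequalities for solutions -/

namespace IsSolution

variable {T : Set ℝ} {t₀ : ℝ} {A α F : ℝ → ℝ} {ν s x₀ : ℝ} {φ x : ℝ → ℝ}

theorem neg (hx : IsSolution T A α s x₀ φ x) :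
    IsSolution T A α s (-x₀) (fun t => -φ t) (fun t => -x t) := by
  obtain ⟨h1, h2, h3, N, hN, hNd, hd⟩ := hx
  refine ⟨by rw [h1], fun t ht => by rw [h2 t ht], h3.neg, N, hN, hNd, fun t ht htN ε hε => ?_⟩
  filter_upwards [hd t ht htN ε hε] with u hu
  rw [← abs_neg]
  convert hu using 2
  ring

theorem sub_le (P : DelayHypotheses T t₀ A α F ν) (hs : t₀ ≤ s) (hx : IsSolution T A α s x₀ φ x)
    {a b C : ℝ} (ha : a ∈ T ∩ Ici s) (hb : b ∈ T) (hab : a ≤ b)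
    (hC : ∀ t ∈ T ∩ Ico a b, -x (α t) ≤ C) : x b - x a ≤ C * (F b - F a) := by
  obtain ⟨-, -, hc, N, hN, hNd, hd⟩ := hx
  have hsub : (T ∩ Ici s) ∩ Icc a b ⊆ T ∩ Ici s := inter_subset_left
  have h : (fun t => x t + (-C) * F t) b ≤ (fun t => x t + (-C) * F t) a := by
    refine le_of_deltaDeriv_nonpos (P.isClosed_Ici s) (g := fun t => x t + (-C) * F t)
      (g' := fun t => -(A t * x (α t)) + (-C) * A t) ha ⟨hb, le_trans (mem_Ici.1 ha.2) hab⟩ hab ?_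
      (N := N ∩ Ici s) (hN.mono inter_subset_left) ?_ ?_
    · exact (hc.mono hsub).add (continuousOn_const.mul (P.continuousOn.mono fun t ht =>
        ⟨ht.1.1, hs.trans ht.1.2⟩))
    · intro t ht
      rw [sigma_inter_Ici ht.2]
      exact hNd t ht.1
    · intro t ht htN
      have ht0 : t ∈ T ∩ Ici t₀ := ⟨ht.1.1, hs.trans ht.1.2⟩
      refine ⟨(hd t ht.1 fun h => htN ⟨h, ht.1.2⟩).add_const_mul
        ((P.deriv t ht0).inter_Ici hs ht.1.2) _, ?_⟩
      have h1 := P.coeff_nonneg t ht0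
      have h2 := hC t ⟨ht.1.1, ht.2⟩
      nlinarith
  simp only at h
  linarith

theorem jump (P : DelayHypotheses T t₀ A α F ν) (hs : t₀ ≤ s) (hx : IsSolution T A α s x₀ φ x)
    {t : ℝ} (ht : t ∈ T ∩ Ici s) (hσ : t < sigma T t) :
    x (sigma T t) = x t - (F (sigma T t) - F t) * x (α t) := by
  obtain ⟨-, -, hc, N, hN, hNd, hd⟩ := hx
  have h1 := (hd t ht fun h => hσ.ne' (hNd t h)).jump ht
  have h2 := ((P.deriv t ⟨ht.1, hs.trans ht.2⟩).inter_Ici hs ht.2).jump ht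
  rw [sigma_inter_Ici ht.2] at h1 h2
  linear_combination h1 + x (α t) * h2

theorem continuousWithinAt_right (hx : IsSolution T A α s x₀ φ x) {t : ℝ} (ht : t ∈ T ∩ Ici s) :
    ContinuousWithinAt x (T ∩ Ioi t) t :=
  (hx.continuousOn t ht).mono fun _ hu => ⟨hu.1, le_trans (mem_Ici.1 ht.2) (le_of_lt hu.2)⟩

/-- Between `α t` and `t` the solution increases by at most `ν M`, as `[α t, t]` lies in one window
and the slope is at most `M A`. The number `L` bounds the delayed arguments of the window from
below. -/
theorem le_delayed_add (P : DelayHypotheses T t₀ A α F ν) (hs : t₀ ≤ s)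
    (hx : IsSolution T A α s x₀ φ x) {t L M : ℝ} (ht : t ∈ T ∩ Ici t₀) (hst : s ≤ alphaStar T α t)
    (hL : ∀ η ∈ T, alphaStar T α t ≤ η → L ≤ α η) (hM : ∀ u ∈ T ∩ Icc L t, |x u| ≤ M) :
    x t ≤ x (α t) + ν * M := by
  have hαt := P.alphaStar_le ht.2 ht.1 le_rfl
  have hαT := P.delay_mem t ht
  have hαle := P.delay_le t ht
  have hLt : L ≤ t := (hL t ht.1 (P.alphaStar_le_self ht)).trans hαle
  have hM0 : 0 ≤ M := (abs_nonneg _).trans (hM t ⟨ht.1, hLt, le_rfl⟩)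
  have h1 := hx.sub_le P hs (a := α t) (b := t) (C := M) ⟨hαT, hst.trans hαt⟩ ht.1 hαle (by
    intro η hη
    have hη0 : η ∈ T ∩ Ici t₀ := ⟨hη.1, hs.trans (hst.trans (hαt.trans hη.2.1))⟩
    have := hM (α η) ⟨P.delay_mem η hη0, hL η hη.1 (hαt.trans hη.2.1),
      (P.delay_le η hη0).trans hη.2.2.le⟩
    linarith [(abs_le.1 this).1])
  have h2 := P.sub_le_of_mem_window ht ⟨hαT, hs.trans (hst.trans hαt)⟩ hαt
  have h3 := mul_le_mul_of_nonneg_left h2 hM0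
  linarith

/-- While `|x| ≤ M` on the relevant past, the solution cannot cross a level `c > ν M` upwards. -/
theorem barrier_step (P : DelayHypotheses T t₀ A α F ν) (hs : t₀ ≤ s)
    (hx : IsSolution T A α s x₀ φ x) {t L M c : ℝ} (ht : t ∈ T ∩ Ici t₀)
    (hst : s ≤ alphaStar T α t)
    (hL : ∀ η ∈ T, alphaStar T α t ≤ η → L ≤ α η) (hM : ∀ u ∈ T ∩ Icc L t, |x u| ≤ M)
    (hc : ν * M < c) (hxt : x t ≤ c) :
    (t < sigma T t → x (sigma T t) ≤ c) ∧
      (sigma T t = t → ∀ᶠ u in 𝓝[T ∩ Ioi t] t, x u ≤ c) := by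
  have hsts : s ≤ t := hst.trans (P.alphaStar_le_self ht)
  have hLt : L ≤ t := (hL t ht.1 (P.alphaStar_le_self ht)).trans (P.delay_le t ht)
  refine ⟨fun hσ => ?_, fun hσ => ?_⟩
  · have hσT := sigma_mem P.closed P.not_bddAbove t
    have hσ0 : sigma T t ∈ T ∩ Ici t₀ := ⟨hσT, le_trans (mem_Ici.1 ht.2) hσ.le⟩
    rw [hx.jump P hs ⟨ht.1, hsts⟩ hσ]
    have hb0 : 0 ≤ F (sigma T t) - F t := sub_nonneg.2 (P.mono ht hσT hσ.le)
    rcases le_or_gt 0 (x (α t)) with h | h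
    · nlinarith
    · -- Since `α (σ t) ≤ t`, the jump lies in the window ending at `σ t`, so that
      -- `F (σ t) - F t ≤ ν < 1`.
      have hb1 := P.sub_le_of_mem_window hσ0 ht
        ((P.alphaStar_le hσ0.2 hσT le_rfl).trans (P.delay_sigma_le t ht))
      have := hx.le_delayed_add P hs ht hst hL hM
      nlinarith [P.lt_one]
  · have hcont := hx.continuousWithinAt_right (t := t) ⟨ht.1, hsts⟩
    rcases hxt.lt_or_eq with hlt | heq
    · exact (hcont.tendsto.eventually_lt_const hlt).mono fun u hu => hu.le
    · -- Slightly enlarging `M` gives room for a whole right neighbourhood of `t`.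
      obtain ⟨M', hMM', hM'c⟩ : ∃ M', M < M' ∧ ν * M' < c :=
        ⟨M + (c - ν * M) / 2, by linarith, by nlinarith [P.lt_one, P.pos]⟩
      have hev : ∀ᶠ u in 𝓝[T ∩ Ioi t] t, |x u| < M' ∧ ν * M' < x u :=
        (hcont.abs.tendsto.eventually_lt_const
          ((hM t ⟨ht.1, hLt, le_rfl⟩).trans_lt hMM')).and
          (hcont.tendsto.eventually_const_lt (by rw [heq]; exact hM'c))
      rw [eventually_nhdsWithin_iff, Metric.eventually_nhds_iff] at hev
      obtain ⟨δ, hδ, hev⟩ := hev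
      rw [eventually_nhdsWithin_iff, Metric.eventually_nhds_iff]
      refine ⟨δ, hδ, fun u hu hut => ?_⟩
      have htu : t < u := hut.2
      rw [Real.dist_eq, abs_of_pos (sub_pos.2 htu)] at hu
      have hnear : ∀ v ∈ T ∩ Icc t u, |x v| ≤ M' ∧ ν * M' < x v := by
        intro v hv
        rcases hv.2.1.lt_or_eq with h | h
        · have := hev (y := v) (by
            rw [Real.dist_eq, abs_of_pos (sub_pos.2 h)]; linarith [hv.2.2]) ⟨hv.1, h⟩
          exact ⟨this.1.le, this.2⟩
        · rw [← h]
          exact ⟨(hM t ⟨ht.1, hLt, le_rfl⟩).trans hMM'.le, by rw [heq]; exact hM'c⟩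
      have h1 := hx.sub_le P hs (a := t) (b := u) (C := 0) ⟨ht.1, hsts⟩ hut.1 htu.le (by
        intro η hη
        by_contra! hneg
        have hη0 : η ∈ T ∩ Ici t₀ := ⟨hη.1, le_trans (mem_Ici.1 ht.2) hη.2.1⟩
        have hmono := P.alphaStar_mono ht.2 hη.2.1
        have h2 := hx.le_delayed_add P hs hη0 (hst.trans hmono)
          (fun v hv hv1 => hL v hv (hmono.trans hv1)) (L := L) (M := M') (by
            intro v hv
            rcases le_total v t with h | h
            · exact (hM v ⟨hv.1, hv.2.1, h⟩).trans hMM'.le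
            · exact (hnear v ⟨hv.1, h, hv.2.2.trans hη.2.2.le⟩).1)
        linarith [(hnear η ⟨hη.1, hη.2.1, hη.2.2.le⟩).2])
      rw [zero_mul] at h1
      linarith

/-! ### Uniform bounds -/

/-- Grönwall bound. The factor `2` in the exponent absorbs the fact that, near a right-dense point,
the delayed values are only bounded by slightly more than the current bound. -/
theorem abs_le_mul_exp (P : DelayHypotheses T t₀ A α F ν) (hs : s ∈ T ∩ Ici t₀)
    (hx : IsSolution T A α s x₀ φ x) {D : ℝ} (hD : 0 < D)
    (hinit : ∀ u ∈ T ∩ Icc (alphaStar T α s) s, |x u| ≤ D) {t : ℝ} (ht : t ∈ T ∩ Ici s) :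
    |x t| ≤ D * Real.exp (2 * (F t - F s)) := by
  have hIcc : T ∩ Icc s t ⊆ T ∩ Ici s := fun u hu => ⟨hu.1, hu.2.1⟩
  have hIci : T ∩ Ici s ⊆ T ∩ Ici t₀ := fun u hu => ⟨hu.1, le_trans (mem_Ici.1 hs.2) hu.2⟩
  have hsT : s ∈ T ∩ Ici s := ⟨hs.1, self_mem_Ici⟩
  set E : ℝ → ℝ := fun t => D * Real.exp (2 * (F t - F s)) with hE
  have hEc : ContinuousOn E (T ∩ Ici s) :=
    continuousOn_const.mul (Real.continuous_exp.comp_continuousOn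
      (continuousOn_const.mul ((P.continuousOn.mono hIci).sub continuousOn_const)))
  have hEmono : ∀ {u v : ℝ}, u ∈ T ∩ Ici s → v ∈ T → u ≤ v → E u ≤ E v := by
    intro u v hu hv huv
    have := P.mono (hIci hu) hv huv
    simp only [hE]
    gcongr
  have hEs : E s = D := by simp [hE]
  have hEpos : ∀ u, 0 < E u := fun u => by simp only [hE]; positivity
  -- The increment of the exponential dominates twice its value times the increment of `F`.
  have hEinc : ∀ u v, 2 * E u * (F v - F u) ≤ E v - E u := by
    intro u v
    have h1 := Real.add_one_le_exp (2 * (F v - F u))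
    have h2 : E v = E u * Real.exp (2 * (F v - F u)) := by
      simp only [hE]
      rw [mul_assoc, ← Real.exp_add]
      congr 2
      ring
    rw [h2]
    nlinarith [hEpos u]
  -- Values at delayed arguments: either initial data or values already estimated.
  have hdelay : ∀ {η r B : ℝ}, η ∈ T → s ≤ η → η ≤ r → D ≤ B →
      (∀ u ∈ T ∩ Icc s r, |x u| ≤ B) → |x (α η)| ≤ B := by
    intro η r B hη hsη hηr hDB hB
    have hη0 : η ∈ T ∩ Ici t₀ := hIci ⟨hη, hsη⟩
    have hαT := P.delay_mem η hη0
    rcases le_total (α η) s with h | h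
    · exact (hinit _ ⟨hαT, P.alphaStar_le hs.2 hη hsη, h⟩).trans hDB
    · exact hB _ ⟨hαT, h, (P.delay_le η hη0).trans hηr⟩
  refine le_induction (g := fun t => |x t|) (h := E) P.closed hs.1
    (hx.continuousOn.mono hIcc).abs (hEc.mono hIcc) ?_ ?_ ?_ t ⟨ht.1, ht.2, le_rfl⟩
  · rw [hEs]
    exact hinit s ⟨hs.1, P.alphaStar_le_self hs, le_rfl⟩
  · intro r hr hσ hle
    have hrs : r ∈ T ∩ Ici s := ⟨hr.1, hr.2.1⟩
    have hσT := sigma_mem P.closed P.not_bddAbove r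
    have hF : 0 ≤ F (sigma T r) - F r := sub_nonneg.2 (P.mono (hIci hrs) hσT hσ.le)
    have h1 : |x (α r)| ≤ E r := hdelay hr.1 hr.2.1 le_rfl
      (by rw [← hEs]; exact hEmono hsT hr.1 hr.2.1)
      (fun u hu => (hle u hu).trans (hEmono (hIcc ⟨hu.1, hu.2.1, hu.2.2.trans hr.2.2.le⟩) hr.1
        hu.2.2))
    have h2 := hle r ⟨hr.1, hr.2.1, le_rfl⟩
    have h3 := hEinc r (sigma T r)
    rw [hx.jump P hs.2 hrs hσ]
    refine (abs_sub _ _).trans ?_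
    rw [abs_mul, abs_of_nonneg hF]
    have := mul_le_mul_of_nonneg_left h1 hF
    nlinarith [mul_nonneg (hEpos r).le hF]
  · intro r hr hσ hle
    have hrs : r ∈ T ∩ Ici s := ⟨hr.1, hr.2.1⟩
    have hDE : D ≤ E r := by rw [← hEs]; exact hEmono hsT hr.1 hr.2.1
    have h2 : |x r| ≤ E r := hle r ⟨hr.1, hr.2.1, le_rfl⟩
    have hev : ∀ᶠ u in 𝓝[T ∩ Ioi r] r, |x u| < 2 * E r :=
      (hx.continuousWithinAt_right hrs).abs.tendsto.eventually_lt_const (by linarith [hEpos r])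
    rw [eventually_nhdsWithin_iff, Metric.eventually_nhds_iff] at hev
    obtain ⟨δ, hδ, hev⟩ := hev
    rw [eventually_nhdsWithin_iff, Metric.eventually_nhds_iff]
    refine ⟨δ, hδ, fun u hu hut => ?_⟩
    have hru : r < u := hut.2
    rw [Real.dist_eq, abs_of_pos (sub_pos.2 hru)] at hu
    have hB : ∀ v ∈ T ∩ Icc s u, |x v| ≤ 2 * E r := by
      intro v hv
      rcases le_or_gt v r with h | h
      · have h3 : |x v| ≤ E v := hle v ⟨hv.1, hv.2.1, h⟩
        have := hEmono (hIcc ⟨hv.1, hv.2.1, h.trans hr.2.2.le⟩) hr.1 h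
        linarith [hEpos r]
      · exact (hev (y := v) (by
          rw [Real.dist_eq, abs_of_pos (sub_pos.2 h)]; linarith [hv.2.2]) ⟨hv.1, h⟩).le
    have hα : ∀ η ∈ T ∩ Ico r u, |x (α η)| ≤ 2 * E r := fun η hη =>
      hdelay hη.1 (hr.2.1.trans hη.2.1) hη.2.2.le (by linarith [hEpos r]) hB
    have h4 := hx.sub_le P hs.2 hrs hut.1 hru.le (C := 2 * E r) fun η hη => by
      linarith [(abs_le.1 (hα η hη)).1]
    have h5 := hx.neg.sub_le P hs.2 hrs hut.1 hru.le (C := 2 * E r) fun η hη => by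
      linarith [(abs_le.1 (hα η hη)).2]
    have h6 := hEinc r u
    have h7 := abs_le.1 h2
    rw [abs_le]
    constructor <;> linarith

/-- A solution never exceeds twice its bound on `[s, α_{-1}(s)]`; beyond `α_{-1}(s)` the delayed
arguments are at least `s` and the barrier argument applies. The factor `2` accounts for a possible
jump at `α_{-1}(s)` itself. -/
theorem abs_le_of_init (P : DelayHypotheses T t₀ A α F ν) (hs : s ∈ T ∩ Ici t₀)
    (hx : IsSolution T A α s x₀ φ x) {D K : ℝ} (hD : 0 < D)
    (hinit : ∀ u ∈ T ∩ Icc (alphaStar T α s) s, |x u| ≤ D)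
    (hK : F (alphaInv T t₀ α s) - F s ≤ K) {t : ℝ} (ht : t ∈ T ∩ Ici (alphaStar T α s)) :
    |x t| ≤ 2 * (D * Real.exp (2 * K)) := by
  set τ := alphaInv T t₀ α s with hτ
  set B := D * Real.exp (2 * K) with hB
  have hBpos : 0 < B := by positivity
  have hτT : τ ∈ T := P.alphaInv_mem hs
  have hsτ : s ≤ τ := P.le_alphaInv hs
  have hτ0 : τ ∈ T ∩ Ici t₀ := ⟨hτT, le_trans (mem_Ici.1 hs.2) hsτ⟩
  have hstar := P.alphaStar_le_self hs
  have hearly : ∀ u ∈ T ∩ Icc (alphaStar T α s) τ, |x u| ≤ B := by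
    intro u hu
    have hFτ := P.mono hs hτT hsτ
    rcases le_total u s with h | h
    · refine (hinit u ⟨hu.1, hu.2.1, h⟩).trans ?_
      exact le_mul_of_one_le_right hD.le (Real.one_le_exp (by linarith))
    · refine (hx.abs_le_mul_exp P hs hD hinit ⟨hu.1, h⟩).trans ?_
      have := P.mono ⟨hu.1, le_trans (mem_Ici.1 hs.2) h⟩ hτT hu.2.2
      rw [hB]
      gcongr
      linarith
  rcases le_total t τ with htτ | htτ
  · linarith [hearly t ⟨ht.1, ht.2, htτ⟩]
  have hpast : ∀ {r : ℝ}, (∀ u ∈ T ∩ Icc τ r, |x u| ≤ 2 * B) →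
      ∀ u ∈ T ∩ Icc (alphaStar T α s) r, |x u| ≤ 2 * B := by
    intro r h u hu
    rcases le_total u τ with h1 | h1
    · linarith [hearly u ⟨hu.1, hu.2.1, h1⟩]
    · exact h u ⟨hu.1, h1, hu.2.2⟩
  have hstep : ∀ {r : ℝ}, r ∈ T → τ < r → (∀ u ∈ T ∩ Icc τ r, |x u| ≤ 2 * B) →
      (r < sigma T r → |x (sigma T r)| ≤ 2 * B) ∧
        (sigma T r = r → ∀ᶠ u in 𝓝[T ∩ Ioi r] r, |x u| ≤ 2 * B) := by
    intro r hr hτr hle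
    have hr0 : r ∈ T ∩ Ici t₀ := ⟨hr, le_trans (mem_Ici.1 hτ0.2) hτr.le⟩
    have hsr := P.lt_alphaStar_of_alphaInv_lt hr0 hτr
    have hL : ∀ η ∈ T, alphaStar T α r ≤ η → alphaStar T α s ≤ α η := fun η hη h =>
      P.alphaStar_le hs.2 hη (hsr.le.trans h)
    have hr1 := abs_le.1 (hle r ⟨hr, hτr.le, le_rfl⟩)
    have hν : ν * (2 * B) < 2 * B := by nlinarith [P.lt_one]
    obtain ⟨p1, p2⟩ := hx.barrier_step P hs.2 hr0 hsr.le hL (hpast hle) hν hr1.2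
    obtain ⟨n1, n2⟩ := hx.neg.barrier_step P hs.2 hr0 hsr.le hL
      (M := 2 * B) (by simpa only [abs_neg] using hpast hle) hν (by linarith)
    refine ⟨fun h => abs_le.2 ⟨by linarith [n1 h], p1 h⟩, fun h => ?_⟩
    filter_upwards [p2 h, n2 h] with u h1 h2
    exact abs_le.2 ⟨by linarith, h1⟩
  have hτB : |x τ| ≤ B := hearly τ ⟨hτT, hstar.trans hsτ, le_rfl⟩
  refine le_induction (g := fun t => |x t|) (h := fun _ => 2 * B) P.closed hτT
    (hx.continuousOn.mono fun u hu => ⟨hu.1, hsτ.trans hu.2.1⟩).abs continuousOn_const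
    (b := t) (by linarith) ?_ ?_ t ⟨ht.1, htτ, le_rfl⟩
  · intro r hr hσ hle
    rcases hr.2.1.lt_or_eq with h | h
    · exact (hstep hr.1 h hle).1 hσ
    · -- The jump at `τ` lies in the window ending at `σ τ`.
      rw [← h] at hσ ⊢
      have hσT := sigma_mem P.closed P.not_bddAbove τ
      have hσ0 : sigma T τ ∈ T ∩ Ici t₀ := ⟨hσT, le_trans (mem_Ici.1 hτ0.2) hσ.le⟩
      have hF0 : 0 ≤ F (sigma T τ) - F τ := sub_nonneg.2 (P.mono hτ0 hσT hσ.le)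
      have hF1 := P.sub_le_of_mem_window hσ0 hτ0
        ((P.alphaStar_le hσ0.2 hσT le_rfl).trans (P.delay_sigma_le τ hτ0))
      have hα : |x (α τ)| ≤ B := hearly _ ⟨P.delay_mem τ hτ0, P.alphaStar_le hs.2 hτT hsτ,
        P.delay_le τ hτ0⟩
      rw [hx.jump P hs.2 ⟨hτT, hsτ⟩ hσ]
      refine (abs_sub _ _).trans ?_
      rw [abs_mul, abs_of_nonneg hF0]
      nlinarith [P.lt_one]
  · intro r hr hσ hle
    rcases hr.2.1.lt_or_eq with h | h
    · exact (hstep hr.1 h hle).2 hσ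
    · rw [← h]
      exact ((hx.continuousWithinAt_right ⟨hτT, hsτ⟩).abs.tendsto.eventually_lt_const
        (show |x τ| < 2 * B by linarith)).mono fun u hu => hu.le

/-- The bound of `abs_le_of_init`, with the size of the initial data measured as in the definition
of uniform stability. The supremum there is a genuine one, as `φ` is bounded. -/
theorem abs_le_of_norm_lt (P : DelayHypotheses T t₀ A α F ν) (hs : s ∈ T ∩ Ici t₀)
    (hx : IsSolution T A α s x₀ φ x) (hφ : RdContinuousOn T (T ∩ Icc (alphaStar T α s) s) φ)
    {D K : ℝ} (hD : |x₀| + sSup ((fun η => |φ η|) '' (T ∩ Ico (alphaStar T α s) s)) < D)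
    (hK : F (alphaInv T t₀ α s) - F s ≤ K) {t : ℝ} (ht : t ∈ T ∩ Ici (alphaStar T α s)) :
    |x t| ≤ 2 * (D * Real.exp (2 * K)) := by
  have hsup : 0 ≤ sSup ((fun η => |φ η|) '' (T ∩ Ico (alphaStar T α s) s)) :=
    Real.sSup_nonneg (by rintro _ ⟨u, -, rfl⟩; exact abs_nonneg _)
  refine hx.abs_le_of_init P hs (by linarith [abs_nonneg x₀]) ?_ hK ht
  intro u hu
  rcases hu.2.2.lt_or_eq with h | h
  · obtain ⟨C, hC⟩ := (hφ.isBounded_image P.not_bddAbove inter_subset_left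
      (isCompact_Icc.inter_left P.closed) Subset.rfl).exists_norm_le
    have hbdd : BddAbove ((fun η => |φ η|) '' (T ∩ Ico (alphaStar T α s) s)) := by
      refine ⟨C, ?_⟩
      rintro _ ⟨v, hv, rfl⟩
      exact hC _ ⟨v, ⟨hv.1, hv.2.1, hv.2.2.le⟩, rfl⟩
    have hu' : u ∈ T ∩ Ico (alphaStar T α s) s := ⟨hu.1, hu.2.1, h⟩
    rw [hx.initial_function u hu']
    have := le_csSup hbdd (mem_image_of_mem (fun η => |φ η|) hu')
    linarith [abs_nonneg x₀]
  · rw [h, hx.initial_value]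
    linarith

/-! ### Attraction -/

/-- An eventual bound `M` improves to the eventual upper bound `ν M`. As `∫ A = ∞`, the solution
cannot stay above `ν M` forever, and once below this level it is trapped there. -/
theorem eventually_le_mul (P : DelayHypotheses T t₀ A α F ν) (hF : Tendsto F (atTopIn T) atTop)
    (hs : s ∈ T ∩ Ici t₀) (hx : IsSolution T A α s x₀ φ x) {M : ℝ} (hM0 : 0 < M)
    (hM : ∀ᶠ t in atTopIn T, |x t| ≤ M) : ∀ᶠ t in atTopIn T, x t ≤ ν * M := by
  obtain ⟨T₁, hT₁⟩ := eventually_atTopIn.1 hM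
  obtain ⟨R₁, hR₁⟩ := P.exists_delay_ge T₁
  obtain ⟨R₂, hR₂⟩ := P.exists_alphaStar_ge (max R₁ s)
  have hνM : 0 < ν * M := mul_pos P.pos hM0
  have hst : ∀ {t}, R₂ ≤ t → s ≤ alphaStar T α t := fun h => (le_max_right _ _).trans (hR₂ _ h)
  have hL : ∀ {t}, R₂ ≤ t → ∀ η ∈ T, alphaStar T α t ≤ η → T₁ ≤ α η := fun h η hη h1 =>
    hR₁ η hη (((le_max_left _ _).trans (hR₂ _ h)).trans h1)
  obtain ⟨t₂, ht₂, hR₂t, hst₂, hxt₂⟩ : ∃ t ∈ T, R₂ ≤ t ∧ s ≤ t ∧ x t ≤ ν * M := by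
    by_contra! hcon
    obtain ⟨R₃, hR₃⟩ := P.exists_delay_ge (max R₂ s)
    obtain ⟨t₃, ht₃, hmax⟩ := not_bddAbove_iff.1 P.not_bddAbove (max R₃ (max R₂ s))
    have h1 : R₃ ≤ t₃ := (le_max_left _ _).trans hmax.le
    have h2 : R₂ ≤ t₃ := ((le_max_left _ _).trans (le_max_right _ _)).trans hmax.le
    have h3 : s ≤ t₃ := ((le_max_right _ _).trans (le_max_right _ _)).trans hmax.le
    obtain ⟨R₄, hR₄⟩ := eventually_atTopIn.1
      (hF.eventually_ge_atTop (F t₃ + x t₃ / (ν * M)))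
    obtain ⟨t₄, ht₄, hmax₄⟩ := not_bddAbove_iff.1 P.not_bddAbove (max R₄ t₃)
    have h4 := hR₄ t₄ ht₄ ((le_max_left _ _).trans hmax₄.le)
    have h34 : t₃ ≤ t₄ := (le_max_right _ _).trans hmax₄.le
    have h5 := hx.sub_le P hs.2 ⟨ht₃, h3⟩ ht₄ h34 (C := -(ν * M)) (by
      intro η hη
      have hη0 : η ∈ T ∩ Ici t₀ := ⟨hη.1, le_trans (mem_Ici.1 hs.2) (h3.trans hη.2.1)⟩
      have h6 := hR₃ η hη.1 (h1.trans hη.2.1)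
      have := hcon (α η) (P.delay_mem η hη0) ((le_max_left _ _).trans h6)
        ((le_max_right _ _).trans h6)
      linarith)
    have h6 := hcon t₄ ht₄ (h2.trans h34) (h3.trans h34)
    have h7 : x t₃ / (ν * M) ≤ F t₄ - F t₃ := by linarith
    rw [div_le_iff₀ hνM] at h7
    nlinarith
  rw [eventually_atTopIn]
  refine ⟨t₂, fun t ht ht₂t => le_of_forall_gt_imp_ge_of_dense fun c hc => ?_⟩
  have hstep : ∀ r ∈ T ∩ Ico t₂ t, (∀ u ∈ T ∩ Icc t₂ r, x u ≤ c) → _ := fun r hr hle =>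
    hx.barrier_step P hs.2 (t := r) (L := T₁) (M := M) (c := c)
      ⟨hr.1, le_trans (mem_Ici.1 hs.2) (hst₂.trans hr.2.1)⟩ (hst (hR₂t.trans hr.2.1))
      (hL (hR₂t.trans hr.2.1)) (fun u hu => hT₁ u hu.1 hu.2.1) hc (hle r ⟨hr.1, hr.2.1, le_rfl⟩)
  exact le_induction (g := x) (h := fun _ => c) P.closed ht₂
    (hx.continuousOn.mono fun u hu => ⟨hu.1, hst₂.trans hu.2.1⟩) continuousOn_const
    (hxt₂.trans hc.le) (fun r hr hσ hle => (hstep r hr hle).1 hσ)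
    (fun r hr hσ hle => (hstep r hr hle).2 hσ) t ⟨ht, ht₂t, le_rfl⟩

theorem tendsto_zero (P : DelayHypotheses T t₀ A α F ν) (hF : Tendsto F (atTopIn T) atTop)
    (hs : s ∈ T ∩ Ici t₀) (hx : IsSolution T A α s x₀ φ x) {M : ℝ} (hM0 : 0 < M)
    (hM : ∀ᶠ t in atTopIn T, |x t| ≤ M) : Tendsto x (atTopIn T) (𝓝 0) := by
  have hpow : ∀ n : ℕ, ∀ᶠ t in atTopIn T, |x t| ≤ ν ^ n * M := by
    intro n
    induction n with
    | zero => simpa using hM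
    | succ n ih =>
      have hpos : 0 < ν ^ n * M := mul_pos (pow_pos P.pos n) hM0
      have h1 := hx.eventually_le_mul P hF hs hpos ih
      have h2 := hx.neg.eventually_le_mul P hF hs hpos (by simpa only [abs_neg] using ih)
      filter_upwards [h1, h2] with t ht1 ht2
      rw [pow_succ', mul_assoc]
      exact abs_le.2 ⟨by linarith, ht1⟩
  rw [Metric.tendsto_nhds]
  intro ε hε
  have hlim : Tendsto (fun n : ℕ => ν ^ n * M) atTop (𝓝 (0 * M)) :=
    (tendsto_pow_atTop_nhds_zero_of_lt_one P.pos.le P.lt_one).mul_const M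
  rw [zero_mul] at hlim
  obtain ⟨n, hn⟩ := (hlim.eventually_lt_const hε).exists
  filter_upwards [hpow n] with t ht
  rw [Real.dist_eq, sub_zero]
  exact ht.trans_lt hn

end IsSolution

/-- If the `Δ`-integral of `f` over `[t₀, t]` tends to infinity, then it is not the default value
`0`, so it is given by an antiderivative. -/
theorem exists_antiderivative {T S : Set ℝ} (hub : ¬ BddAbove T) {f : ℝ → ℝ} {t₀ : ℝ}
    (h : Tendsto (fun t => deltaIntegral S f t₀ t) (atTopIn T) atTop) :
    ∃ F : ℝ → ℝ, (∀ t ∈ S, HasDeltaDerivAt S F (f t) t) ∧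
      ∀ a b, deltaIntegral S f a b = F b - F a := by
  by_cases hex : ∃ F : ℝ → ℝ, ∀ t ∈ S, HasDeltaDerivAt S F (f t) t
  · exact ⟨hex.choose, hex.choose_spec, fun a b => by rw [deltaIntegral, dif_pos hex]⟩
  · have := atTopIn_neBot hub
    obtain ⟨t, ht⟩ := (h.eventually_gt_atTop 0).exists
    rw [deltaIntegral, dif_neg hex] at ht
    exact absurd ht (lt_irrefl 0)

end TimeScale

/-! ### Global asymptotic stability -/

theorem mainTheorem2 (T : Set ℝ) (hT : IsClosed T) (hTub : ¬ BddAbove T)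
    (t₀ : ℝ) (ht₀ : t₀ ∈ T) (A α : ℝ → ℝ)
    (hA : TimeScale.RdContinuousOn T (T ∩ Set.Ici t₀) A)
    (hA0 : ∀ t ∈ T ∩ Set.Ici t₀, 0 ≤ A t)
    (hα : TimeScale.RdContinuousOn T (T ∩ Set.Ici t₀) α)
    (hαT : ∀ t ∈ T ∩ Set.Ici t₀, α t ∈ T)
    (hαlim : Filter.Tendsto α (TimeScale.atTopIn T) Filter.atTop)
    (hA1 : ∀ t ∈ T ∩ Set.Ici t₀, α t ≤ t)
    (hA2 : ∀ t ∈ T ∩ Set.Ici t₀, α (TimeScale.sigma T t) ≤ t)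
    (hK : ∃ K : ℝ, ∀ s ∈ T ∩ Set.Ici t₀,
      TimeScale.deltaIntegral (T ∩ Set.Ici t₀) A s (TimeScale.alphaInv T t₀ α s) ≤ K)
    (hInt : Filter.Tendsto (fun t => TimeScale.deltaIntegral (T ∩ Set.Ici t₀) A t₀ t)
      (TimeScale.atTopIn T) Filter.atTop)
    (hsup : ∃ ν < (1 : ℝ), ∀ t ∈ T ∩ Set.Ici t₀,
      TimeScale.deltaIntegral (T ∩ Set.Ici t₀) A (max t₀ (TimeScale.alphaStar T α t)) t ≤ ν) :
    TimeScale.GloballyAsymptoticallyStable T t₀ A α := by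
  obtain ⟨F, hFd, hFint⟩ := TimeScale.exists_antiderivative hTub hInt
  obtain ⟨K, hK⟩ := hK
  obtain ⟨ν, hν1, hν⟩ := hsup
  simp only [hFint] at hK hν hInt
  have hF : Tendsto F (TimeScale.atTopIn T) atTop := by
    simpa using tendsto_atTop_add_const_right _ (F t₀) hInt
  have P : TimeScale.DelayHypotheses T t₀ A α F (max ν (1 / 2)) :=
    ⟨hT, hTub, ht₀, hA0, hα, hαT, hαlim, hA1, hA2, hFd,
      fun t ht => (hν t ht).trans (le_max_left _ _),
      lt_max_of_lt_right (by norm_num), max_lt hν1 (by norm_num)⟩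
  constructor
  · intro ε hε
    refine ⟨ε / (4 * Real.exp (2 * K)), by positivity, fun s hs x₀ φ x hφ hx hsmall t ht => ?_⟩
    have h1 := hx.abs_le_of_norm_lt P hs hφ hsmall (hK s hs) (t := t)
      ⟨ht.1, (P.alphaStar_le_self hs).trans ht.2⟩
    have h2 : 2 * (ε / (4 * Real.exp (2 * K)) * Real.exp (2 * K)) = ε / 2 := by
      field_simp
      norm_num
    linarith
  · intro s hs x₀ φ x hφ hx
    set D := |x₀| + sSup ((fun η => |φ η|) '' (T ∩ Ico (TimeScale.alphaStar T α s) s)) + 1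
    have hb : ∀ t ∈ T ∩ Ici (TimeScale.alphaStar T α s), |x t| ≤ 2 * (D * Real.exp (2 * K)) :=
      fun t ht => hx.abs_le_of_norm_lt P hs hφ (lt_add_one _) (hK s hs) ht
    refine hx.tendsto_zero P hF hs (M := 2 * (D * Real.exp (2 * K)) + 1) ?_ ?_
    · have := (abs_nonneg _).trans (hb s ⟨hs.1, P.alphaStar_le_self hs⟩)
      linarith
    · refine TimeScale.eventually_atTopIn.2 ⟨TimeScale.alphaStar T α s, fun t ht hst => ?_⟩
      linarith [hb t ⟨ht, hst⟩]
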